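/- Let $\mathbb R^3_1$ be $\mathbb R^3$ with the scalar product $\langle x,y\rangle=-x_0y_0+x_1y_1+x_2y_2$; a vector $x\neq 0$ is lightlike if $\langle x,x\rangle=0$, and $LC^*$ denotes the set of lightlike vectors. All maps are $C^\infty$. Let $U\subset\mathbb R^2$ be a domain and $f:U\to\mathbb R^3_1$ a frontal with isotropic lift $(f,[\nu])$, i.e. $[\nu]:U\to P\mathbb R^3$ is smooth and $\langle df_p(X),\nu(p)\rangle=0$ for all $p\in U$ and $X\in T_pU$. Let $\nu^\perp(p)$ be the limiting tangent plane, and let $L(f)$ be the set of $p\in U$ at which $\nu(p)$ is lightlike. Assume that $f$ is admissible near a point $p\in L(f)$: the set $L(f)$ is a regular curve, parametrized near $p=\gamma(0)$ by a regular curve $\gamma:(-\varepsilon,\varepsilon)\to U$; if $p$ is a singular point of $f$, then $\gamma'(0)\notin\ker df_p$; and $\hat\gamma'(u)$ is not lightlike for any $u$, where $\hat\gamma=f\circ\gamma$. Let $u$ be an arclength parameter, $e=\hat\gamma'$ with $\langle e,e\rangle=1$, and let $\{e,\mathbf L,\mathbf N\}$ be a smooth frame along $\hat\gamma$ with $$\langle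 e,\mathbf L\rangle=\langle e,\mathbf N\rangle=\langle \mathbf L,\mathbf L\rangle=\langle \mathbf N,\mathbf N\rangle=0,\qquad \langle \mathbf L,\mathbf N\rangle=1,$$ such that $e(u),\mathbf L(u)$ span $\nu^\perp(\gamma(u))$. Set $\alpha_L=\langle\hat\gamma'',\mathbf L\rangle$ and $\alpha_N=\langle\hat\gamma'',\mathbf N\rangle$. For a vector $v=(v_0,v_1,v_2)$ with $v_0\ne0$ put $\widetilde v=v/v_0$. The osculating and the transversal lightcone pedal are $$LP_L(u)=\langle\hat\gamma(u),\widetilde{\mathbf L(u)}\rangle\,\widetilde{\mathbf L(u)},\qquad LP_N(u)=\langle\hat\gamma(u),\widetilde{\mathbf N(u)}\rangle\,\widetilde{\mathbf N(u)}.$$ **Theorem.** Assume $LP_L(0)\in LC^*$, i.e. $\langle\hat\gamma(0),\mathbf L(0)\rangle\ne0$ (respectively, $LP_N(0)\in LC^*$, i.e. $\langle\hat\gamma(0),\mathbf N(0)\rangle\neq0$). Then $LP_L$ (respectively, $LP_N$) is singular at $u=0$, i.e. its derivative vanishes there, if and only if $\alpha_L(0)=0$ (respectively, $\alpha_N(0)=0$).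 Moreover, $LP_L$ (respectively, $LP_N$) has a $3/2$-cusp at $u=0$ if and only if $\alpha_L(0)=0$ and $\alpha_L'(0)\neq0$ (respectively, $\alpha_N(0)=0$ and $\alpha_N'(0)\ne0$). Here a curve germ in $\mathbb R^3_1$ has a $3/2$-cusp if it is $\mathcal A$-equivalent to $t\mapsto(t^2,t^3,0)$ at $t=0$, i.e. becomes it after diffeomorphism germs of the source and of the target. -/

import Mathlib

open Set Filter Topology
open scoped ContDiff Manifold LinearAlgebra.Projectivization

namespace LightconePedal

/-- The underlying vector space of Lorentz-Minkowski 3-space, with coordinates `(x₀, x₁, x₂)`. -/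
abbrev R31 : Type := Fin 3 → ℝ

/-- The Lorentzian scalar product `⟨x, y⟩ = -x₀y₀ + x₁y₁ + x₂y₂`. -/
def mink (x y : R31) : ℝ := -(x 0 * y 0) + x 1 * y 1 + x 2 * y 2

/-- A non-zero vector `x` with `⟨x, x⟩ = 0`. -/
def IsLightlike (x : R31) : Prop := x ≠ 0 ∧ mink x x = 0

/-- The Lorentzian orthogonal complement `x^⊥` of a vector. -/
def perp (x : R31) : Submodule ℝ R31 where
  carrier := {y | mink x y = 0}
  add_mem' := by
    intro a b ha hb
    simp only [mem_ofPred_eq, mink, Pi.add_apply] at *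
    linear_combination ha + hb
  zero_mem' := by simp [mink]
  smul_mem' := by
    intro c a ha
    simp only [mem_ofPred_eq, mink, Pi.smul_apply, smul_eq_mul] at *
    linear_combination c * ha

/-- Smoothness on the open set `U` of a map into the projective plane `Pℝ³`: near every point it is
represented by a smooth map into `ℝ³ \ {0}`. -/
def SmoothProjOn (ν : ℝ × ℝ → ℙ ℝ R31) (U : Set (ℝ × ℝ)) : Prop :=
  ∀ p ∈ U, ∃ V : Set (ℝ × ℝ), IsOpen V ∧ p ∈ V ∧ ∃ n : ℝ × ℝ → R31, ContDiffOn ℝ ∞ n V ∧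
    ∀ q ∈ V, ∃ h : n q ≠ 0, ν q = Projectivization.mk ℝ (n q) h

/-- `f : U → ℝ³₁` is a (smooth) frontal on the domain `U ⊆ ℝ²` with isotropic lift `(f, [ν])`. -/
structure IsFrontal (U : Set (ℝ × ℝ)) (f : ℝ × ℝ → R31) (ν : ℝ × ℝ → ℙ ℝ R31) : Prop where
  isOpen : IsOpen U
  isConnected : IsConnected U
  smooth : ContDiffOn ℝ ∞ f U
  smooth_lift : SmoothProjOn ν U
  isotropic : ∀ p ∈ U, ∀ X : ℝ × ℝ, mink (fderiv ℝ f p X) (ν p).rep = 0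

/-- The limiting tangent plane `ν^⊥(p)`. -/
noncomputable def limitingTangentPlane (ν : ℝ × ℝ → ℙ ℝ R31) (p : ℝ × ℝ) : Submodule ℝ R31 :=
  perp (ν p).rep

/-- The set `L(f)` of lightlike points: those at which `ν^⊥(p)` is a lightlike plane. -/
def lightlikePoints (U : Set (ℝ × ℝ)) (ν : ℝ × ℝ → ℙ ℝ R31) : Set (ℝ × ℝ) :=
  {p | p ∈ U ∧ IsLightlike (ν p).rep}

/-- The set `S(f)` of singular points: those at which `df_p` has rank less than two. -/
def singularPoints (U : Set (ℝ × ℝ)) (f : ℝ × ℝ → R31) : Set (ℝ × ℝ) :=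
  {p | p ∈ U ∧ ¬ Function.Injective (fderiv ℝ f p)}

/-- `S` is a regular curve in the plane: locally the zero set of a smooth function without critical
points. -/
def IsRegularCurve (S : Set (ℝ × ℝ)) : Prop :=
  ∀ p ∈ S, ∃ V : Set (ℝ × ℝ), IsOpen V ∧ p ∈ V ∧ ∃ h : ℝ × ℝ → ℝ, ContDiffOn ℝ ∞ h V ∧
    (∀ q ∈ V, fderiv ℝ h q ≠ 0) ∧ S ∩ V = {q | q ∈ V ∧ h q = 0}

/-- `f` is an admissible frontal near the lightlike point `γ 0`, and `γ : (-ε, ε) → U` is a regular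
parametrization of `L(f)` near `γ 0`. -/
structure IsAdmissible (U : Set (ℝ × ℝ)) (f : ℝ × ℝ → R31) (ν : ℝ × ℝ → ℙ ℝ R31)
    (ε : ℝ) (γ : ℝ → ℝ × ℝ) : Prop where
  frontal : IsFrontal U f ν
  pos : 0 < ε
  regular : IsRegularCurve (lightlikePoints U ν)
  smooth : ContDiffOn ℝ ∞ γ (Ioo (-ε) ε)
  immersed : ∀ u ∈ Ioo (-ε) ε, deriv γ u ≠ 0
  injective : InjOn γ (Ioo (-ε) ε)
  image : ∃ W : Set (ℝ × ℝ), IsOpen W ∧ γ 0 ∈ W ∧ γ '' Ioo (-ε) ε = lightlikePoints U ν ∩ W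
  not_null : γ 0 ∈ singularPoints U f → fderiv ℝ f (γ 0) (deriv γ 0) ≠ 0
  not_lightlike : ∀ u ∈ Ioo (-ε) ε, ¬ IsLightlike (deriv (f ∘ γ) u)

/-- `{e, L, N}` with `e = (f ∘ γ)'` is a smooth frame along `f ∘ γ` satisfying the stated scalar
product relations (in particular the parameter is arclength), and `e, L` span the limiting tangent
plane. -/
structure IsFrame (f : ℝ × ℝ → R31) (ν : ℝ × ℝ → ℙ ℝ R31) (ε : ℝ) (γ : ℝ → ℝ × ℝ)
    (L N : ℝ → R31) : Prop where
  smooth_L : ContDiffOn ℝ ∞ L (Ioo (-ε) ε)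
  smooth_N : ContDiffOn ℝ ∞ N (Ioo (-ε) ε)
  ee : ∀ u ∈ Ioo (-ε) ε, mink (deriv (f ∘ γ) u) (deriv (f ∘ γ) u) = 1
  eL : ∀ u ∈ Ioo (-ε) ε, mink (deriv (f ∘ γ) u) (L u) = 0
  eN : ∀ u ∈ Ioo (-ε) ε, mink (deriv (f ∘ γ) u) (N u) = 0
  LL : ∀ u ∈ Ioo (-ε) ε, mink (L u) (L u) = 0
  LN : ∀ u ∈ Ioo (-ε) ε, mink (L u) (N u) = 1
  NN : ∀ u ∈ Ioo (-ε) ε, mink (N u) (N u) = 0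
  tangent : ∀ u ∈ Ioo (-ε) ε,
    Submodule.span ℝ {deriv (f ∘ γ) u, L u} = limitingTangentPlane ν (γ u)

/-- For a curve `c` and a vector field `V` along it, the function `u ↦ ⟨c''(u), V(u)⟩`. With
`c = f ∘ γ` it is `α_L` for `V = L` and `α_N` for `V = N`. -/
noncomputable def alpha (c V : ℝ → R31) (u : ℝ) : ℝ := mink (deriv (deriv c) u) (V u)

/-- The normalization `v / v₀` of a vector, which lies in `S¹₊` when `v` is lightlike. -/
noncomputable def tilde (v : R31) : R31 := (v 0)⁻¹ • v

/-- For a curve `c` and a field `V` of lightlike vectors along it, the lightcone pedal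
`u ↦ ⟨c(u), Ṽ(u)⟩ Ṽ(u)`. With `c = f ∘ γ` it is `LP_L` for `V = L` and `LP_N` for `V = N`. -/
noncomputable def lightconePedal (c V : ℝ → R31) (u : ℝ) : R31 :=
  mink (c u) (tilde (V u)) • tilde (V u)

/-- `𝒜`-equivalence of the germ of `c₁` at `t₁` and the germ of `c₂` at `t₂`: there are
diffeomorphism germs `φ` of the source and `Φ` of the target with `Φ ∘ c₁ = c₂ ∘ φ`. -/
def AEquiv (c₁ : ℝ → R31) (t₁ : ℝ) (c₂ : ℝ → R31) (t₂ : ℝ) : Prop :=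
  ∃ (φ : ℝ → ℝ) (Φ : R31 → R31),
    IsLocalDiffeomorphAt 𝓘(ℝ, ℝ) 𝓘(ℝ, ℝ) ∞ φ t₁ ∧ φ t₁ = t₂ ∧
    IsLocalDiffeomorphAt 𝓘(ℝ, R31) 𝓘(ℝ, R31) ∞ Φ (c₁ t₁) ∧ Φ (c₁ t₁) = c₂ t₂ ∧
    ∀ᶠ t in 𝓝 t₁, Φ (c₁ t) = c₂ (φ t)

/-- The curve `c` has a `3/2`-cusp at `t`. -/
def HasCusp (c : ℝ → R31) (t : ℝ) : Prop :=
  AEquiv c t (fun s : ℝ => ![s ^ 2, s ^ 3, 0]) 0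

/-- The parameter `t` is a singular point of the curve `c`. -/
def IsSingularPoint (c : ℝ → R31) (t : ℝ) : Prop := deriv c t = 0

end LightconePedal

open LightconePedal

/-!
Near `0` a field `V` of lightlike normal vectors along a unit speed curve `c` normalizes to
`w = (1, w₁, w₂)` with `(w₁, w₂)` on the unit circle, moving at the angular velocity
`ρ = w₁ w₂' - w₂ w₁'`. With `b = (0, -w₂, w₁)` and `h = ⟨c, w⟩` one has `w' = ρ b`, and
`⟨c', w⟩ = 0` gives `h' = ρ g` for `g = ⟨c, b⟩`. Hence the pedal `P = h w` satisfies
`P' = ρ (g w + h b)`, where the second factor has no zero at `0` if `h 0 ≠ 0`. Differentiating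
`⟨c', V⟩ = 0` yields `⟨c'', V⟩ = -V₀ ⟨c', b⟩ ρ`, and `⟨c', b⟩ ^ 2 = ⟨c', c'⟩ = 1`; so `⟨c'', V⟩` and
`ρ` have the same zeros and the same simple zeros (`exists_isConeFront_lightconePedal`). It remains to
see that `P` is singular exactly at the zeros of `ρ`, which is immediate, and that it has a
`3/2`-cusp exactly at the simple ones.

If `Φ ∘ P = (φ ^ 2, φ ^ 3, 0)` with diffeomorphism germs `φ` and `Φ`, the derivative of the first
component is `ρ` times a function on one side and has a simple zero on the other, so the zero of `ρ`
is simple (`IsConeFront.simple_zero_of_hasCusp`).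

Conversely, suitable coordinates straighten the lightcone to a plane and `P` to a plane curve
`(x, h)`, with `x` the sine of the angle of rotation of `(w₁, w₂)`; there `h' = q x'`, and a simple
zero of `ρ` is a simple zero of `x'` at which `q' ≠ 0`, since there `g' = ⟨c', b⟩ = ±1`. Such a curve
has a `3/2`-cusp (`hasCusp_of_front`): in a parameter with `x = ± s ^ 2` the function `h` has the form
`A (s ^ 2) + s ^ 3 C (s ^ 2)` with `C 0 ≠ 0`, and `(x, y) ↦ (x, (y - A x) / C x)` is the change of
coordinates in the target. The smoothness of `A` and `C` on both sides of `0` is Whitney's theorem on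
even functions (`exists_contDiff_comp_sq_of_even`), deduced from the lemmas of Hadamard and Borel.
-/

namespace LightconePedal

/-! ### Hadamard's lemma -/

lemma hasDerivAt_integral_pow_mul_comp_mul {h : ℝ → ℝ} (hh : ContDiff ℝ ∞ h) (m : ℕ) (s : ℝ) :
    HasDerivAt (fun s => ∫ t in (0 : ℝ)..1, t ^ m * h (t * s))
      (∫ t in (0 : ℝ)..1, t ^ (m + 1) * deriv h (t * s)) s := by
  have hc : Continuous h := hh.continuous
  have hd : Continuous (deriv h) := (contDiff_infty_iff_deriv.1 hh).2.continuous
  obtain ⟨C, hC⟩ := (isCompact_Icc (a := -(|s| + 1)) (b := |s| + 1)).exists_bound_of_continuousOn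
    hd.continuousOn
  refine (intervalIntegral.hasDerivAt_integral_of_dominated_loc_of_deriv_le
    (F := fun s t => t ^ m * h (t * s)) (F' := fun s t => t ^ (m + 1) * deriv h (t * s))
    (bound := fun _ => C) (Metric.ball_mem_nhds s one_pos) ?_ ?_ ?_ ?_ ?_ ?_).2
  · exact Eventually.of_forall fun x => (by fun_prop : Continuous _).aestronglyMeasurable
  · exact (by fun_prop : Continuous _).intervalIntegrable _ _
  · exact (by fun_prop : Continuous _).aestronglyMeasurable
  · refine Eventually.of_forall fun t ht x hx => ?_
    rw [uIoc_of_le zero_le_one] at ht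
    have hx' : |x| ≤ |s| + 1 := by
      have h1 : |x - s| < 1 := by simpa [Real.dist_eq] using hx
      have h2 := abs_add_le (x - s) s
      rw [sub_add_cancel] at h2
      linarith
    have htx : |t * x| ≤ |s| + 1 := by
      rw [abs_mul, abs_of_pos ht.1]
      nlinarith [abs_nonneg x, ht.1, ht.2]
    have h1 := hC (t * x) (abs_le.1 htx)
    rw [norm_mul, norm_pow, Real.norm_of_nonneg ht.1.le]
    have h2 : t ^ (m + 1) ≤ 1 := pow_le_one₀ ht.1.le ht.2
    nlinarith [norm_nonneg (deriv h (t * x)), pow_nonneg ht.1.le (m + 1)]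
  · exact intervalIntegrable_const
  · refine Eventually.of_forall fun t _ x _ => ?_
    have h1 : HasDerivAt h (deriv h (t * x)) (t * x) :=
      ((contDiff_infty_iff_deriv.1 hh).1 _).hasDerivAt
    have h2 : HasDerivAt (fun x => t * x) t x := by
      simpa using (hasDerivAt_id x).const_mul t
    exact ((h1.comp x h2).const_mul (t ^ m)).congr_deriv (by ring)

lemma contDiff_integral_pow_mul_comp_mul {h : ℝ → ℝ} (hh : ContDiff ℝ ∞ h) (m : ℕ) :
    ContDiff ℝ ∞ (fun s => ∫ t in (0 : ℝ)..1, t ^ m * h (t * s)) := by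
  rw [contDiff_infty]
  intro n
  induction n generalizing h m with
  | zero =>
    exact contDiff_zero.2 (continuous_iff_continuousAt.2 fun s =>
      (hasDerivAt_integral_pow_mul_comp_mul hh m s).continuousAt)
  | succ n ih =>
    push_cast
    rw [contDiff_succ_iff_deriv]
    refine ⟨fun s => (hasDerivAt_integral_pow_mul_comp_mul hh m s).differentiableAt, by simp, ?_⟩
    rw [funext fun s => (hasDerivAt_integral_pow_mul_comp_mul hh m s).deriv]
    exact ih (contDiff_infty_iff_deriv.1 hh).2 (m + 1)

/-- Hadamard's lemma. -/
lemma exists_contDiff_eq_add_mul {f : ℝ → ℝ} (hf : ContDiff ℝ ∞ f) :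
    ∃ g : ℝ → ℝ, ContDiff ℝ ∞ g ∧ ∀ s, f s = f 0 + s * g s := by
  have hd := (contDiff_infty_iff_deriv.1 hf).2
  refine ⟨_, contDiff_integral_pow_mul_comp_mul hd 0, fun s => ?_⟩
  have h1 : ∀ t ∈ uIcc (0 : ℝ) 1, HasDerivAt (fun t => f (t * s)) (deriv f (t * s) * s) t := by
    intro t _
    have h2 : HasDerivAt (fun t => t * s) s t := by simpa using (hasDerivAt_id t).mul_const s
    exact (((contDiff_infty_iff_deriv.1 hf).1 _).hasDerivAt).comp t h2
  have h3 := intervalIntegral.integral_eq_sub_of_hasDerivAt h1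
    (((hd.continuous.comp (by fun_prop)).mul continuous_const).intervalIntegrable _ _)
  rw [intervalIntegral.integral_mul_const] at h3
  simp only [one_mul, zero_mul, pow_zero] at h3 ⊢
  linarith

/-! ### Borel's lemma -/

/-- Borel's lemma: every sequence of reals is the sequence of derivatives at `0` of a smooth
function. -/
lemma exists_contDiff_iteratedDeriv_zero_eq (a : ℕ → ℝ) :
    ∃ B : ℝ → ℝ, ContDiff ℝ ∞ B ∧ ∀ k, iteratedDeriv k B 0 = a k := by
  let χ : ContDiffBump (0 : ℝ) := ⟨1, 2, one_pos, one_lt_two⟩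
  let g : ℕ → ℝ → ℝ := fun n y => (a n / n.factorial * y ^ n) * χ y
  have hg : ∀ n, ContDiff ℝ ∞ (g n) := fun n =>
    (contDiff_const.mul (contDiff_id.pow n)).mul χ.contDiff
  have hg0 : ∀ n k, iteratedDeriv k (g n) 0 = if k = n then a n else 0 := by
    intro n k
    have h1 : g n =ᶠ[𝓝 0] fun y => a n / n.factorial * y ^ n := by
      filter_upwards [χ.eventuallyEq_one] with y hy
      simp [g, hy]
    rw [h1.iteratedDeriv_eq, iteratedDeriv_const_mul_field, iteratedDeriv_fun_pow_zero]
    split_ifs with h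
    · field_simp
    · simp
  have hbd : ∀ n k, ∃ C, ∀ x, ‖iteratedDeriv k (g n) x‖ ≤ C := by
    intro n k
    have hcs : HasCompactSupport (g n) := χ.hasCompactSupport.mul_left
    obtain ⟨C, hC⟩ := (hcs.iteratedFDeriv (𝕜 := ℝ) k).exists_bound_of_continuous
      ((hg n).continuous_iteratedFDeriv (by exact_mod_cast le_top))
    exact ⟨C, fun x => by simpa [norm_iteratedFDeriv_eq_norm_iteratedDeriv] using hC x⟩
  choose C hC using hbd
  -- Rescaling by a large factor `b n` makes the derivatives of order `< n` of the `n`-th term small.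
  have hb : ∀ n, ∃ b : ℝ, 1 ≤ b ∧ ∀ k < n, 2 ^ n * C n k ≤ b := by
    intro n
    refine ⟨1 + ∑ k ∈ Finset.range n, |2 ^ n * C n k|, ?_, fun k hk => ?_⟩
    · have := Finset.sum_nonneg (s := Finset.range n) fun k _ => abs_nonneg (2 ^ n * C n k)
      linarith
    · have := Finset.single_le_sum (f := fun k => |2 ^ n * C n k|) (fun k _ => abs_nonneg _)
        (Finset.mem_range.2 hk)
      have h2 := le_abs_self (2 ^ n * C n k)
      linarith
  choose b hb1 hb using hb
  have hb0 : ∀ n, 0 < b n := fun n => one_pos.trans_le (hb1 n)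
  let T : ℕ → ℝ → ℝ := fun n x => (b n ^ n)⁻¹ * g n (b n * x)
  have hT : ∀ n, ContDiff ℝ ∞ (T n) := fun n =>
    contDiff_const.mul ((hg n).comp (contDiff_const.mul contDiff_id))
  have hTd : ∀ n k x, iteratedDeriv k (T n) x =
      (b n ^ n)⁻¹ * (b n ^ k * iteratedDeriv k (g n) (b n * x)) := by
    intro n k x
    rw [iteratedDeriv_const_mul_field,
      iteratedDeriv_comp_const_mul ((hg n).of_le (by exact_mod_cast le_top))]
  let v : ℕ → ℕ → ℝ := fun k n =>
    if k < n then (1 / 2) ^ n else (b n ^ n)⁻¹ * (b n ^ k * C n k)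
  have hv : ∀ k, Summable (v k) := by
    intro k
    refine (summable_congr_cofinite ?_).2 summable_geometric_two
    rw [Nat.cofinite_eq_atTop]
    filter_upwards [eventually_gt_atTop k] with n hn
    simp [v, hn]
  have hTv : ∀ k n x, ‖iteratedFDeriv ℝ k (T n) x‖ ≤ v k n := by
    intro k n x
    rw [norm_iteratedFDeriv_eq_norm_iteratedDeriv, hTd, norm_mul, norm_mul, norm_inv, norm_pow,
      norm_pow, Real.norm_of_nonneg (hb0 n).le]
    have h1 : (b n ^ n)⁻¹ * (b n ^ k * ‖iteratedDeriv k (g n) (b n * x)‖) ≤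
        (b n ^ n)⁻¹ * (b n ^ k * C n k) := by
      have := hb0 n
      gcongr
      exact hC n k _
    refine h1.trans ?_
    by_cases hk : k < n
    · simp only [v, hk, if_true]
      have hp := pow_pos (hb0 n) n
      rw [inv_mul_le_iff₀ hp, one_div, inv_pow, ← div_eq_mul_inv, le_div_iff₀ (by positivity)]
      calc b n ^ k * C n k * 2 ^ n = b n ^ k * (2 ^ n * C n k) := by ring
        _ ≤ b n ^ k * b n := mul_le_mul_of_nonneg_left (hb n k hk) (pow_pos (hb0 n) k).le
        _ = b n ^ (k + 1) := (pow_succ _ _).symm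
        _ ≤ b n ^ n := pow_le_pow_right₀ (hb1 n) hk
    · simp [v, hk]
  refine ⟨fun x => ∑' n, T n x, contDiff_tsum (N := ⊤) hT (fun k _ => hv k)
    (fun k n x _ => hTv k n x), fun k => ?_⟩
  have h1 := iteratedFDeriv_tsum_apply (𝕜 := ℝ) (N := ⊤) hT (fun k _ => hv k)
    (fun k n x _ => hTv k n x) (k := k) le_top 0
  have hs : Summable fun n => iteratedFDeriv ℝ k (T n) 0 :=
    Summable.of_norm_bounded (hv k) fun n => hTv k n 0
  have h2 : iteratedDeriv k (fun x => ∑' n, T n x) 0 = ∑' n, iteratedDeriv k (T n) 0 := by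
    simp only [iteratedDeriv_eq_iteratedFDeriv, h1]
    exact (ContinuousMultilinearMap.tsum_eval hs _)
  rw [h2, tsum_eq_single k]
  · rw [hTd]
    simp only [mul_zero, hg0, if_true]
    have := pow_pos (hb0 k) k
    field_simp
  · intro n hn
    rw [hTd]
    simp [hg0, hn.symm]

/-! ### Whitney's theorem on even functions -/

/-- The operator `f ↦ f' / (2 s)` on smooth even functions, which corresponds to `d / dv` under
`v = s ^ 2`. -/
lemma exists_even_contDiff_deriv_eq {f : ℝ → ℝ} (hf : ContDiff ℝ ∞ f) (he : ∀ s, f (-s) = f s) :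
    ∃ g : ℝ → ℝ, (ContDiff ℝ ∞ g ∧ ∀ s, g (-s) = g s) ∧ ∀ s, deriv f s = 2 * s * g s := by
  obtain ⟨g, hg, hfg⟩ := exists_contDiff_eq_add_mul (contDiff_infty_iff_deriv.1 hf).2
  have hodd : ∀ s, deriv f (-s) = -deriv f s := by
    intro s
    have h1 := deriv_comp_neg f s
    rw [show (fun x => f (-x)) = f from funext he] at h1
    linarith
  have h0 : deriv f 0 = 0 := by
    have := hodd 0
    rw [neg_zero] at this
    linarith
  simp only [h0, zero_add] at hfg
  refine ⟨fun s => g s / 2, ⟨hg.div_const 2, fun s => ?_⟩, fun s => by rw [hfg s]; ring⟩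
  rcases eq_or_ne s 0 with rfl | hs
  · simp
  · have h1 := hodd s
    rw [hfg, hfg s] at h1
    have : g (-s) = g s := mul_left_cancel₀ hs (by linarith)
    simp only [this]

/-- Whitney's theorem: a smooth even function of `s` is a smooth function of `s ^ 2`. For `v ≥ 0`
the `k`-th derivative of the sought function `A` is `F k (√v)`, where `F k` is the `k`-th iterate of
`f ↦ f' / (2 s)`; Borel's lemma supplies the continuation to `v < 0`. -/
theorem exists_contDiff_comp_sq_of_even {f : ℝ → ℝ} (hf : ContDiff ℝ ∞ f)
    (he : ∀ s, f (-s) = f s) :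
    ∃ A : ℝ → ℝ, ContDiff ℝ ∞ A ∧ ∀ s, f s = A (s ^ 2) := by
  choose D hD hDd using fun (f : {f : ℝ → ℝ // ContDiff ℝ ∞ f ∧ ∀ s, f (-s) = f s}) =>
    exists_even_contDiff_deriv_eq f.2.1 f.2.2
  let F : ℕ → {f : ℝ → ℝ // ContDiff ℝ ∞ f ∧ ∀ s, f (-s) = f s} := fun n =>
    n.rec ⟨f, hf, he⟩ fun _ p => ⟨D p, hD p⟩
  have hF : ∀ n s, HasDerivAt (F n).1 (2 * s * (F (n + 1)).1 s) s := fun n s => by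
    rw [show 2 * s * (F (n + 1)).1 s = deriv (F n).1 s from (hDd (F n) s).symm]
    exact ((contDiff_infty_iff_deriv.1 (F n).2.1).1 s).hasDerivAt
  obtain ⟨B, hB, hBF⟩ := exists_contDiff_iteratedDeriv_zero_eq fun k => (F k).1 0
  have hBd : ∀ k v, HasDerivAt (iteratedDeriv k B) (iteratedDeriv (k + 1) B v) v := fun k v => by
    rw [iteratedDeriv_succ]
    exact ((hB.differentiable_iteratedDeriv k (by exact_mod_cast WithTop.coe_lt_top _)) v).hasDerivAt
  let A : ℕ → ℝ → ℝ := fun k v => if 0 ≤ v then (F k).1 (√v) else iteratedDeriv k B v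
  have hAc : ∀ k, Continuous (A k) := fun k => by
    refine Continuous.if_le ?_ ?_ continuous_const continuous_id ?_
    · exact (F k).2.1.continuous.comp Real.continuous_sqrt
    · exact continuous_iff_continuousAt.2 fun v => (hBd k v).continuousAt
    · intro v hv
      simp [← hv, hBF]
  have hA : ∀ k v, HasDerivAt (A k) (A (k + 1) v) v := by
    have hne : ∀ k v, v ≠ 0 → HasDerivAt (A k) (A (k + 1) v) v := by
      intro k v hv
      rcases hv.lt_or_gt with h | h
      · have h1 : A k =ᶠ[𝓝 v] iteratedDeriv k B := by
          filter_upwards [gt_mem_nhds h] with w hw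
          simp [A, not_le.2 hw]
        simpa [A, not_le.2 h] using (hBd k v).congr_of_eventuallyEq h1
      · have h1 : A k =ᶠ[𝓝 v] fun v => (F k).1 (√v) := by
          filter_upwards [lt_mem_nhds h] with w hw
          simp [A, hw.le]
        have h2 := ((hF k (√v)).comp v (Real.hasDerivAt_sqrt hv)).congr_of_eventuallyEq h1
        refine h2.congr_deriv ?_
        have := Real.sqrt_pos.2 h
        simp only [A, h.le, if_true]
        field_simp
    intro k v
    exact hasDerivAt_of_hasDerivAt_of_ne' (fun y hy => hne k y hy) (hAc k).continuousAt
      (hAc (k + 1)).continuousAt v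
  have hAs : ∀ n : ℕ, ∀ k, ContDiff ℝ n (A k) := by
    intro n
    induction n with
    | zero => exact fun k => contDiff_zero.2 (hAc k)
    | succ n ih =>
      intro k
      push_cast
      rw [contDiff_succ_iff_deriv]
      refine ⟨fun v => (hA k v).differentiableAt, by simp, ?_⟩
      rw [funext fun v => (hA k v).deriv]
      exact ih (k + 1)
  refine ⟨A 0, contDiff_infty.2 fun n => hAs n 0, fun s => ?_⟩
  have h1 : f |s| = f s := by
    rcases abs_choice s with h | h <;> rw [h]
    exact he s
  simp only [A, sq_nonneg, if_true, Real.sqrt_sq_eq_abs]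
  exact h1.symm

/-- The decomposition of a smooth function into smooth functions of `s ^ 2`, its even part and the
quotient by `s` of its odd part. -/
lemma exists_contDiff_eq_comp_sq_add_mul_comp_sq {f : ℝ → ℝ} (hf : ContDiff ℝ ∞ f) :
    ∃ A B : ℝ → ℝ, ContDiff ℝ ∞ A ∧ ContDiff ℝ ∞ B ∧ ∀ s, f s = A (s ^ 2) + s * B (s ^ 2) := by
  have hfn : ContDiff ℝ ∞ fun s => f (-s) := hf.comp contDiff_neg
  obtain ⟨A, hA, hfA⟩ := exists_contDiff_comp_sq_of_even (f := fun s => (f s + f (-s)) / 2)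
    ((hf.add hfn).div_const 2) (fun s => by simp only [neg_neg]; ring)
  obtain ⟨g, hg, hfg⟩ := exists_contDiff_eq_add_mul ((hf.sub hfn).div_const 2)
  simp only [neg_zero, sub_self, zero_div, zero_add] at hfg
  obtain ⟨B, hB, hgB⟩ := exists_contDiff_comp_sq_of_even hg fun s => by
    rcases eq_or_ne s 0 with rfl | hs
    · simp
    · have h1 := hfg (-s)
      have h2 := hfg s
      rw [neg_neg] at h1
      exact mul_left_cancel₀ hs (by linarith)
  refine ⟨A, B, hA, hB, fun s => ?_⟩
  have h1 := hfg s
  have h2 := hfA s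
  rw [← hgB, ← h1, ← h2]
  ring

/-! ### Germs of smooth maps and of diffeomorphisms -/

/-- A function that is smooth near `0` has the germ of a function that is smooth everywhere. -/
lemma exists_contDiff_eventuallyEq {f : ℝ → ℝ} (hf : ∀ᶠ t in 𝓝 0, ContDiffAt ℝ ∞ f t) :
    ∃ F : ℝ → ℝ, ContDiff ℝ ∞ F ∧ F =ᶠ[𝓝 0] f := by
  obtain ⟨r, hr, hball⟩ := Metric.eventually_nhds_iff_ball.1 hf
  let χ : ContDiffBump (0 : ℝ) := ⟨r / 4, r / 2, by positivity, by linarith⟩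
  refine ⟨fun t => χ t * f t, contDiff_iff_contDiffAt.2 fun t => ?_, ?_⟩
  · by_cases ht : t ∈ tsupport χ
    · refine χ.contDiff.contDiffAt.mul (hball t ?_)
      rw [χ.tsupport_eq] at ht
      exact Metric.closedBall_subset_ball (by simp only [χ]; linarith) ht
    · refine contDiffAt_const (c := 0) |>.congr_of_eventuallyEq ?_
      filter_upwards [notMem_tsupport_iff_eventuallyEq.1 ht] with s hs
      simp [hs]
  · filter_upwards [χ.eventuallyEq_one] with t ht
    simp [ht]

section LocalDiffeo

variable {E : Type*} [NormedAddCommGroup E] [NormedSpace ℝ E]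

/-- The inverse function theorem, for germs of smooth maps of a space to itself. -/
lemma isLocalDiffeomorphAt_of_injective_fderiv [FiniteDimensional ℝ E] {f : E → E} {a : E}
    (hf : ∀ᶠ x in 𝓝 a, ContDiffAt ℝ ∞ f x) (hinj : Function.Injective (fderiv ℝ f a)) :
    IsLocalDiffeomorphAt 𝓘(ℝ, E) 𝓘(ℝ, E) ∞ f a := by
  have : CompleteSpace E := FiniteDimensional.complete ℝ E
  have ha : ContDiffAt ℝ ∞ f a := hf.self_of_nhds
  let e' : E ≃L[ℝ] E :=
    (LinearEquiv.ofInjectiveEndo (fderiv ℝ f a).toLinearMap hinj).toContinuousLinearEquiv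
  have he' : (e' : E →L[ℝ] E) = fderiv ℝ f a := by
    ext x
    rfl
  have hder : HasFDerivAt f (e' : E →L[ℝ] E) a := by
    rw [he']
    exact (ha.differentiableAt (by simp)).hasFDerivAt
  have hcont : ContinuousAt (fderiv ℝ f) a :=
    (ha.fderiv_right (m := 0) (by simp)).continuousAt
  have hev : ∀ᶠ x in 𝓝 a, ContDiffAt ℝ ∞ f x ∧
      fderiv ℝ f x ∈ range ((↑) : (E ≃L[ℝ] E) → E →L[ℝ] E) := by
    refine hf.and (hcont.eventually ?_)
    rw [← he']
    exact e'.nhds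
  obtain ⟨V, hV, hVo, haV⟩ := eventually_nhds_iff.1 hev
  let e := (ha.toOpenPartialHomeomorph f hder (by simp)).restrOpen V hVo
  have he : ∀ x ∈ e.source, x ∈ V := fun x hx => hx.2
  refine ⟨⟨e.toPartialEquiv, e.open_source, e.open_target, ?_, ?_⟩,
    ⟨ha.mem_toOpenPartialHomeomorph_source hder (by simp), haV⟩, fun x _ => rfl⟩
  · exact contMDiffOn_iff_contDiffOn.2 fun x hx => (hV x (he x hx)).1.contDiffWithinAt
  · refine contMDiffOn_iff_contDiffOn.2 fun y hy => ContDiffAt.contDiffWithinAt ?_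
    have hx := e.map_target hy
    obtain ⟨g', hg'⟩ := (hV _ (he _ hx)).2
    have hs := (hV _ (he _ hx)).1
    refine e.contDiffAt_symm hy (f₀' := g') ?_ hs
    rw [hg']
    exact (hs.differentiableAt (by simp)).hasFDerivAt

lemma exists_local_inverse {f : E → E} {a : E}
    (hf : IsLocalDiffeomorphAt 𝓘(ℝ, E) 𝓘(ℝ, E) ∞ f a) :
    ∃ ψ : E → E, (∀ᶠ y in 𝓝 (f a), ContDiffAt ℝ ∞ ψ y) ∧ ψ (f a) = a ∧
      (∀ᶠ x in 𝓝 a, ψ (f x) = x) ∧ ∀ᶠ y in 𝓝 (f a), f (ψ y) = y := by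
  obtain ⟨Φ, ha, hfΦ⟩ := hf
  have ht : f a ∈ Φ.target := by rw [hfΦ ha]; exact Φ.map_source ha
  have hleft : ∀ x ∈ Φ.source, Φ.invFun (f x) = x := fun x hx => by
    rw [hfΦ hx]; exact Φ.left_inv hx
  refine ⟨Φ.invFun, ?_, hleft a ha, ?_, ?_⟩
  · filter_upwards [Φ.open_target.mem_nhds ht] with y hy
    exact (contMDiffOn_iff_contDiffOn.1 Φ.contMDiffOn_invFun).contDiffAt
      (Φ.open_target.mem_nhds hy)
  · filter_upwards [Φ.open_source.mem_nhds ha] with x hx using hleft x hx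
  · filter_upwards [Φ.open_target.mem_nhds ht] with y hy
    exact (hfΦ (Φ.map_target hy)).trans (Φ.right_inv hy)

lemma injective_fderiv_of_isLocalDiffeomorphAt {f : E → E} {a : E}
    (hf : IsLocalDiffeomorphAt 𝓘(ℝ, E) 𝓘(ℝ, E) ∞ f a) : Function.Injective (fderiv ℝ f a) := by
  obtain ⟨ψ, hψ, -, hl, -⟩ := exists_local_inverse hf
  have h1 : HasFDerivAt f (fderiv ℝ f a) a :=
    (contMDiffAt_iff_contDiffAt.1 hf.contMDiffAt).differentiableAt (by simp) |>.hasFDerivAt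
  have h2 : HasFDerivAt ψ (fderiv ℝ ψ (f a)) (f a) :=
    (hψ.self_of_nhds.differentiableAt (by simp)).hasFDerivAt
  have h3 := (h2.comp a h1).unique ((hasFDerivAt_id a).congr_of_eventuallyEq hl)
  refine Function.LeftInverse.injective (g := fderiv ℝ ψ (f a)) fun x => ?_
  simpa using DFunLike.congr_fun h3 x

end LocalDiffeo

/-- A `3/2`-cusp is preserved by a change of coordinates in the target. -/
lemma HasCusp.of_comp {c d : ℝ → R31} {t : ℝ} {Φ : R31 → R31} (hd : HasCusp d t)
    (hΦ : IsLocalDiffeomorphAt 𝓘(ℝ, R31) 𝓘(ℝ, R31) ∞ Φ (c t)) (hcd : ∀ᶠ s in 𝓝 t, Φ (c s) = d s) :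
    HasCusp c t := by
  obtain ⟨φ, Ψ, hφ, hφ0, hΨ, hΨ0, h⟩ := hd
  rw [← hcd.self_of_nhds] at hΨ hΨ0
  refine ⟨φ, Ψ ∘ Φ, hφ, hφ0, hΦ.comp _ _ hΨ, hΨ0, ?_⟩
  filter_upwards [h, hcd] with s h1 h2
  rw [Function.comp_apply, h2, h1]

/-! ### Cusps of plane fronts -/

/-- The component of the derivative of a map to `ℝ³` in a direction, as the derivative of a
component along a line. -/
lemma hasDerivAt_apply_line {Φ : R31 → R31} {a : R31} (hΦ : DifferentiableAt ℝ Φ a) (w : R31)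
    (i : Fin 3) : HasDerivAt (fun t : ℝ => Φ (a + t • w) i) (fderiv ℝ Φ a w i) 0 :=
  (hasDerivAt_pi.1 (hΦ.hasFDerivAt.hasLineDerivAt w)) i

lemma contDiffAt_vec3 {E : Type*} [NormedAddCommGroup E] [NormedSpace ℝ E] {f g h : E → ℝ} {a : E}
    (hf : ContDiffAt ℝ ∞ f a) (hg : ContDiffAt ℝ ∞ g a) (hh : ContDiffAt ℝ ∞ h a) :
    ContDiffAt ℝ ∞ (fun x => ![f x, g x, h x]) a := by
  rw [contDiffAt_pi]
  intro i
  fin_cases i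
  · exact hf
  · exact hg
  · exact hh

/-- The Morse lemma in one variable: near a non-degenerate minimum with value `0` a smooth function
is the square of a local coordinate. -/
lemma exists_normal_form_of_fold {x : ℝ → ℝ} (hx : ∀ᶠ t in 𝓝 0, ContDiffAt ℝ ∞ x t) (hx0 : x 0 = 0)
    (hx1 : deriv x 0 = 0) (hx2 : 0 < deriv (deriv x) 0) :
    ∃ φ : ℝ → ℝ, (∀ᶠ t in 𝓝 0, ContDiffAt ℝ ∞ φ t) ∧ φ 0 = 0 ∧ deriv φ 0 ≠ 0 ∧
      ∀ᶠ t in 𝓝 0, x t = φ t ^ 2 := by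
  obtain ⟨X, hX, hXx⟩ := exists_contDiff_eventuallyEq hx
  obtain ⟨g, hg, hXg⟩ := exists_contDiff_eq_add_mul hX
  obtain ⟨a, ha, hga⟩ := exists_contDiff_eq_add_mul hg
  have hda : ∀ t, HasDerivAt a (deriv a t) t := fun t =>
    ((contDiff_infty_iff_deriv.1 ha).1 t).hasDerivAt
  have hX0 : X 0 = 0 := hXx.self_of_nhds.trans hx0
  have hX1 : ∀ t, HasDerivAt X (g 0 + t * (2 * a t + t * deriv a t)) t := by
    intro t
    have h1 : X = fun t => t * (g 0 + t * a t) := by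
      funext t
      rw [hXg, hX0, hga t]; ring
    rw [h1]
    exact ((hasDerivAt_id t).mul (((hasDerivAt_id t).mul (hda t)).const_add (g 0))).congr_deriv
      (by simp only [id, Pi.mul_apply]; ring)
  have hg0 : g 0 = 0 := by
    have h1 := hXx.deriv_eq
    rw [(hX1 0).deriv, hx1] at h1
    linarith
  have hXa : ∀ t, X t = t ^ 2 * a t := fun t => by
    rw [hXg, hX0, hga t, hg0]; ring
  have ha0 : 0 < a 0 := by
    have h1 := hXx.deriv.deriv_eq
    have h2 : HasDerivAt (deriv X) (2 * a 0) 0 := by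
      rw [funext fun t => (hX1 t).deriv, hg0]
      have h3 : DifferentiableAt ℝ (fun t => 2 * a t + t * deriv a t) 0 :=
        ((contDiff_infty_iff_deriv.1 ha).1.const_mul 2 |>.add (differentiable_id.mul
          ((contDiff_infty_iff_deriv.1 (contDiff_infty_iff_deriv.1 ha).2).1))) 0
      refine (((hasDerivAt_id (0 : ℝ)).mul h3.hasDerivAt).const_add 0).congr_deriv ?_
      simp
    rw [h2.deriv] at h1
    linarith
  have hpos : ∀ᶠ t in 𝓝 0, 0 < a t := ha.continuous.continuousAt.eventually (lt_mem_nhds ha0)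
  have hsm : ∀ᶠ t in 𝓝 0, ContDiffAt ℝ ∞ (fun t => t * √(a t)) t := by
    filter_upwards [hpos] with t ht
    exact contDiffAt_id.mul (ha.contDiffAt.sqrt ht.ne')
  refine ⟨fun t => t * √(a t), hsm, by simp, ?_, ?_⟩
  · have h1 : HasDerivAt (fun t => t * √(a t)) (√(a 0)) 0 := by
      refine ((hasDerivAt_id (0 : ℝ)).mul ((hda 0).sqrt ha0.ne')).congr_deriv ?_
      simp
    rw [h1.deriv]
    exact (Real.sqrt_pos.2 ha0).ne'
  · filter_upwards [hpos, hXx] with t ht h1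
    rw [← h1, hXa, mul_pow, Real.sq_sqrt ht.le]

lemma injective_fderiv_of_deriv_ne_zero {φ : ℝ → ℝ} {t : ℝ} (h : deriv φ t ≠ 0) :
    Function.Injective (fderiv ℝ φ t) := by
  rw [injective_iff_map_eq_zero]
  intro w hw
  rw [← mul_one w, ← smul_eq_mul, map_smul, fderiv_apply_one_eq_deriv, smul_eq_mul] at hw
  exact (mul_eq_zero.1 hw).resolve_right h

/-- Let `H' = 2 s r` near `0` with `r` smooth and `r' 0 ≠ 0`. Then `(s ^ 2, H)` is
`(s ^ 2, A (s ^ 2) + s ^ 3 C (s ^ 2))` with `C` not vanishing at `0`. -/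
lemma exists_eq_comp_sq_add_cube_mul_comp_sq {H r : ℝ → ℝ} (hH : ∀ᶠ s in 𝓝 0, ContDiffAt ℝ ∞ H s)
    (hr : DifferentiableAt ℝ r 0) (hr0 : deriv r 0 ≠ 0)
    (hHr : ∀ᶠ s in 𝓝 0, deriv H s = 2 * s * r s) :
    ∃ A C : ℝ → ℝ, ContDiff ℝ ∞ A ∧ ContDiff ℝ ∞ C ∧ C 0 ≠ 0 ∧
      ∀ᶠ s in 𝓝 0, H s = A (s ^ 2) + s ^ 3 * C (s ^ 2) := by
  obtain ⟨F, hF, hFH⟩ := exists_contDiff_eventuallyEq hH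
  obtain ⟨A, B, hA, hB, hFAB⟩ := exists_contDiff_eq_comp_sq_add_mul_comp_sq hF
  obtain ⟨C, hC, hBC⟩ := exists_contDiff_eq_add_mul hB
  have hsq : ∀ s : ℝ, HasDerivAt (fun s : ℝ => s ^ 2) (2 * s) s := fun s => by
    simpa using hasDerivAt_pow 2 s
  have hd : ∀ {G : ℝ → ℝ}, ContDiff ℝ ∞ G → ∀ s, HasDerivAt (fun s => G (s ^ 2))
      (deriv G (s ^ 2) * (2 * s)) s := fun hG s =>
    (((contDiff_infty_iff_deriv.1 hG).1 _).hasDerivAt).comp s (hsq s)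
  have hFd : ∀ s, HasDerivAt F
      (B 0 + s * (2 * deriv A (s ^ 2) + 3 * s * C (s ^ 2) + 2 * s ^ 3 * deriv C (s ^ 2))) s := by
    intro s
    have h1 : F = fun s => A (s ^ 2) + (B 0 * s + s ^ 3 * C (s ^ 2)) := by
      funext s
      rw [hFAB, hBC]; ring
    rw [h1]
    refine ((hd hA s).add (((hasDerivAt_id s).const_mul (B 0)).add
      ((hasDerivAt_pow 3 s).mul (hd hC s)))).congr_deriv ?_
    push_cast
    ring
  have hFr : ∀ᶠ s in 𝓝 0, deriv F s = 2 * s * r s := by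
    filter_upwards [hFH.deriv, hHr] with s h1 h2
    rw [h1, h2]
  have hB0 : B 0 = 0 := by
    have := hFr.self_of_nhds
    rw [(hFd 0).deriv] at this
    linarith
  set r₁ : ℝ → ℝ := fun s => deriv A (s ^ 2) + s * (3 / 2 * C (s ^ 2) + s ^ 2 * deriv C (s ^ 2))
    with hr₁
  have hr₁d : HasDerivAt r₁ (3 / 2 * C 0) 0 := by
    have hA' := (contDiff_infty_iff_deriv.1 hA).2
    have hC' := (contDiff_infty_iff_deriv.1 hC).2
    refine ((hd hA' 0).add ((hasDerivAt_id (0 : ℝ)).mul (((hd hC 0).const_mul (3 / 2)).add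
      ((hsq 0).mul (hd hC' 0))))).congr_deriv ?_
    simp
  have hrr : r =ᶠ[𝓝 0] r₁ := by
    refine (hr.continuousAt.eventuallyEq_nhds_iff_eventuallyEq_nhdsNE hr₁d.continuousAt).1 ?_
    filter_upwards [hFr.filter_mono nhdsWithin_le_nhds, self_mem_nhdsWithin] with s hs hs0
    rw [(hFd s).deriv, hB0] at hs
    have hs0 : s ≠ 0 := hs0
    refine mul_left_cancel₀ (mul_ne_zero two_ne_zero hs0) ?_
    rw [← hs, hr₁]
    ring
  refine ⟨A, C, hA, hC, fun h0 => hr0 ?_, ?_⟩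
  · rw [hrr.deriv_eq, hr₁d.deriv, h0, mul_zero]
  · filter_upwards [hFH] with s hs
    rw [← hs, hFAB, hBC, hB0]
    ring

lemma isLocalDiffeomorphAt_shear {A C : ℝ → ℝ} (hA : ContDiff ℝ ∞ A) (hC : ContDiff ℝ ∞ C)
    {a : R31} (ha : C (a 0) ≠ 0) :
    IsLocalDiffeomorphAt 𝓘(ℝ, R31) 𝓘(ℝ, R31) ∞
      (fun v : R31 => ![v 0, (v 1 - A (v 0)) / C (v 0), v 2]) a := by
  have hsm : ∀ᶠ v in 𝓝 a, ContDiffAt ℝ ∞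
      (fun v : R31 => ![v 0, (v 1 - A (v 0)) / C (v 0), v 2]) v := by
    have h1 : ∀ᶠ v in 𝓝 a, C (v 0) ≠ 0 :=
      (hC.continuous.comp (continuous_apply 0)).continuousAt.eventually_ne ha
    filter_upwards [h1] with v hv
    have hc : ∀ i : Fin 3, ContDiffAt ℝ ∞ (fun v : R31 => v i) v := fun i => by fun_prop
    exact contDiffAt_vec3 (hc 0) (((hc 1).sub (hA.contDiffAt.comp v (hc 0))).div
      (hC.contDiffAt.comp v (hc 0)) hv) (hc 2)
  refine isLocalDiffeomorphAt_of_injective_fderiv hsm ?_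
  rw [injective_iff_map_eq_zero]
  intro w hw
  have hl := hasDerivAt_apply_line (hsm.self_of_nhds.differentiableAt (by simp)) w
  simp only [hw, Pi.zero_apply] at hl
  have hline : ∀ b c : ℝ, HasDerivAt (fun t : ℝ => b + t * c) c 0 := fun b c => by
    simpa using ((hasDerivAt_id (0 : ℝ)).mul_const c).const_add b
  have h0 : w 0 = 0 := (hline (a 0) (w 0)).unique (by simpa using hl 0)
  have h2 : w 2 = 0 := (hline (a 2) (w 2)).unique (by simpa using hl 2)
  have h1 : w 1 = 0 := by
    have h3 := (((hline (a 1) (w 1)).sub_const (A (a 0))).div_const (C (a 0))).unique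
      (by simpa [h0] using hl 1)
    simpa [ha] using h3
  funext i
  fin_cases i <;> assumption

lemma hasCusp_of_front_of_pos {x y q : ℝ → ℝ} (hx : ∀ᶠ t in 𝓝 0, ContDiffAt ℝ ∞ x t)
    (hy : ∀ᶠ t in 𝓝 0, ContDiffAt ℝ ∞ y t) (hq : DifferentiableAt ℝ q 0) (hx0 : x 0 = 0)
    (hx1 : deriv x 0 = 0) (hx2 : 0 < deriv (deriv x) 0)
    (hyx : ∀ᶠ t in 𝓝 0, deriv y t = q t * deriv x t) (hq1 : deriv q 0 ≠ 0) :
    HasCusp (fun t => ![x t, y t, 0]) 0 := by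
  obtain ⟨φ, hφ, hφ0, hφ1, hxφ⟩ := exists_normal_form_of_fold hx hx0 hx1 hx2
  have hφd := isLocalDiffeomorphAt_of_injective_fderiv hφ (injective_fderiv_of_deriv_ne_zero hφ1)
  obtain ⟨ψ, hψ, hψ0, hψφ, hφψ⟩ := exists_local_inverse hφd
  rw [hφ0] at hψ hψ0 hφψ
  have hψt : Tendsto ψ (𝓝 0) (𝓝 0) := by
    simpa only [ContinuousAt, hψ0] using hψ.self_of_nhds.continuousAt
  have hψd : ∀ᶠ s in 𝓝 0, HasDerivAt ψ (deriv ψ s) s :=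
    hψ.mono fun s hs => (hs.differentiableAt (by simp)).hasDerivAt
  have hdcomp : ∀ {z : ℝ → ℝ}, (∀ᶠ t in 𝓝 0, ContDiffAt ℝ ∞ z t) →
      ∀ᶠ s in 𝓝 0, HasDerivAt (z ∘ ψ) (deriv z (ψ s) * deriv ψ s) s := by
    intro z hz
    filter_upwards [hψt.eventually hz, hψd] with s h1 h2
    exact (h1.differentiableAt (by simp)).hasDerivAt.comp s h2
  have hxψ : x ∘ ψ =ᶠ[𝓝 0] fun s => s ^ 2 := by
    filter_upwards [hψt.eventually hxφ, hφψ] with s h1 h2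
    rw [Function.comp_apply, h1, h2]
  have hψ1 : deriv ψ 0 ≠ 0 := by
    intro h
    have h1 := (hdcomp hφ).self_of_nhds.congr_of_eventuallyEq
      (f₁ := id) (hφψ.mono fun s hs => hs.symm)
    have h2 := h1.unique (hasDerivAt_id 0)
    rw [h, mul_zero] at h2
    exact zero_ne_one h2
  obtain ⟨A, C, hA, hC, hC0, hyAC⟩ := exists_eq_comp_sq_add_cube_mul_comp_sq
    (H := y ∘ ψ) (r := q ∘ ψ)
    (by
      filter_upwards [hψt.eventually hy, hψ] with s h1 h2
      exact h1.comp s h2)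
    (by
      rw [← hψ0] at hq
      exact hq.comp 0 hψd.self_of_nhds.differentiableAt)
    (by
      have h1 : HasDerivAt q (deriv q 0) (ψ 0) := by rw [hψ0]; exact hq.hasDerivAt
      rw [(h1.comp 0 hψd.self_of_nhds).deriv]
      exact mul_ne_zero hq1 hψ1)
    (by
      filter_upwards [hdcomp hy, hdcomp hx, hψt.eventually hyx, hxψ.eventuallyEq_nhds]
        with s h1 h2 h3 h4
      have h5 : deriv x (ψ s) * deriv ψ s = 2 * s :=
        (h2.congr_of_eventuallyEq h4.symm).unique (by simpa using hasDerivAt_pow 2 s)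
      rw [h1.deriv, h3, ← h5, Function.comp_apply]
      ring)
  have hφt : Tendsto φ (𝓝 0) (𝓝 0) := by
    simpa only [ContinuousAt, hφ0] using hφ.self_of_nhds.continuousAt
  have hCx : ∀ᶠ t in 𝓝 0, C (φ t ^ 2) ≠ 0 := by
    have h1 : ContinuousAt (fun t => C (φ t ^ 2)) 0 :=
      hC.continuous.continuousAt.comp (hφ.self_of_nhds.continuousAt.pow 2)
    exact h1.eventually_ne (by simpa [hφ0] using hC0)
  have hform : ∀ᶠ t in 𝓝 0,
      (fun v : R31 => ![v 0, (v 1 - A (v 0)) / C (v 0), v 2]) ![x t, y t, 0] =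
        ![φ t ^ 2, φ t ^ 3, 0] := by
    filter_upwards [hφt.eventually hyAC, hψφ, hxφ, hCx] with t h1 h2 h3 h4
    rw [Function.comp_apply, h2] at h1
    simp only [Matrix.cons_val_zero, Matrix.cons_val_one, Matrix.cons_val, h1, h3,
      add_sub_cancel_left]
    rw [mul_div_cancel_right₀ _ h4]
  refine ⟨φ, _, hφd, hφ0, isLocalDiffeomorphAt_shear hA hC ?_, ?_, hform⟩
  · simpa [hx0] using hC0
  · have h1 := hform.self_of_nhds
    rw [hφ0] at h1
    exact h1

lemma isLocalDiffeomorphAt_neg_zero (a : R31) :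
    IsLocalDiffeomorphAt 𝓘(ℝ, R31) 𝓘(ℝ, R31) ∞ (fun v : R31 => ![-v 0, v 1, v 2]) a := by
  have hc : ∀ (i : Fin 3) (v : R31), ContDiffAt ℝ ∞ (fun v : R31 => v i) v := fun i v => by fun_prop
  have hsm : ∀ v, ContDiffAt ℝ ∞ (fun v : R31 => ![-v 0, v 1, v 2]) v := fun v =>
    contDiffAt_vec3 (hc 0 v).neg (hc 1 v) (hc 2 v)
  have hs := contMDiff_iff_contDiff.2 (contDiff_iff_contDiffAt.2 hsm)
  have hinv : Function.Involutive (fun v : R31 => ![-v 0, v 1, v 2]) := fun v => by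
    funext i
    fin_cases i <;> simp
  exact (Diffeomorph.toPartialDiffeomorph (n := ∞)
    ⟨hinv.toPerm, hs, hs⟩).isLocalDiffeomorphAt _ _ _ (mem_univ a)

/-- A plane curve `(x, y)` whose tangent direction is `(1, q)` has a `3/2`-cusp at a simple zero of
`x'` at which `q' ≠ 0`. -/
theorem hasCusp_of_front {x y q : ℝ → ℝ} (hx : ∀ᶠ t in 𝓝 0, ContDiffAt ℝ ∞ x t)
    (hy : ∀ᶠ t in 𝓝 0, ContDiffAt ℝ ∞ y t) (hq : DifferentiableAt ℝ q 0) (hx0 : x 0 = 0)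
    (hx1 : deriv x 0 = 0) (hx2 : deriv (deriv x) 0 ≠ 0)
    (hyx : ∀ᶠ t in 𝓝 0, deriv y t = q t * deriv x t) (hq1 : deriv q 0 ≠ 0) :
    HasCusp (fun t => ![x t, y t, 0]) 0 := by
  rcases hx2.lt_or_gt with h | h
  · have hnx : deriv (fun t => -x t) = fun t => -deriv x t := funext fun t => deriv.fun_neg
    have hneg := hasCusp_of_front_of_pos (x := fun t => -x t) (q := fun t => -q t)
      (hx.mono fun t ht => ht.neg) hy hq.neg (by simp [hx0]) (by simp [hx1])
      (by rw [hnx, deriv.fun_neg]; linarith) (by simpa [hnx] using hyx)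
      (by simpa using hq1)
    refine hneg.of_comp (isLocalDiffeomorphAt_neg_zero _) (Eventually.of_forall fun t => ?_)
    simp
  · exact hasCusp_of_front_of_pos hx hy hq hx0 hx1 h hyx hq1

/-! ### Fronts on the lightcone -/

/-- Near the parameter `0` the curve `P` is `h (1, w₁, w₂)` with `(w₁, w₂)` moving on the unit circle
at the angular velocity `ρ`, and `h' = ρ g`. The factor `ρ` of `h'` makes `P' = ρ ξ` with
`ξ 0 ≠ 0`, so that `P` is a front on the lightcone. -/
structure IsConeFront (P : ℝ → R31) (h w₁ w₂ ρ g : ℝ → ℝ) : Prop where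
  smooth_h : ∀ᶠ t in 𝓝 0, ContDiffAt ℝ ∞ h t
  smooth_w₁ : ∀ᶠ t in 𝓝 0, ContDiffAt ℝ ∞ w₁ t
  smooth_w₂ : ∀ᶠ t in 𝓝 0, ContDiffAt ℝ ∞ w₂ t
  diff_ρ : DifferentiableAt ℝ ρ 0
  diff_g : DifferentiableAt ℝ g 0
  eq : ∀ᶠ t in 𝓝 0, P t = ![h t, h t * w₁ t, h t * w₂ t]
  circle : ∀ᶠ t in 𝓝 0, w₁ t ^ 2 + w₂ t ^ 2 = 1
  hasDerivAt_w₁ : ∀ᶠ t in 𝓝 0, HasDerivAt w₁ (-(ρ t * w₂ t)) t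
  hasDerivAt_w₂ : ∀ᶠ t in 𝓝 0, HasDerivAt w₂ (ρ t * w₁ t) t
  hasDerivAt_h : ∀ᶠ t in 𝓝 0, HasDerivAt h (ρ t * g t) t
  h_ne_zero : h 0 ≠ 0

lemma hasDerivAt_vec3 {f g h : ℝ → ℝ} {f' g' h' t : ℝ} (hf : HasDerivAt f f' t)
    (hg : HasDerivAt g g' t) (hh : HasDerivAt h h' t) :
    HasDerivAt (fun t => ![f t, g t, h t]) ![f', g', h'] t := by
  rw [hasDerivAt_pi]
  intro i
  fin_cases i
  · exact hf
  · exact hg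
  · exact hh

namespace IsConeFront

variable {P : ℝ → R31} {h w₁ w₂ ρ g : ℝ → ℝ}

lemma hasDerivAt (H : IsConeFront P h w₁ w₂ ρ g) : ∀ᶠ t in 𝓝 0, HasDerivAt P
    (ρ t • ![g t, g t * w₁ t - h t * w₂ t, g t * w₂ t + h t * w₁ t]) t := by
  filter_upwards [H.eq.eventually_nhds, H.hasDerivAt_h, H.hasDerivAt_w₁, H.hasDerivAt_w₂]
    with t h1 h2 h3 h4
  refine ((hasDerivAt_vec3 h2 (h2.mul h3) (h2.mul h4)).congr_of_eventuallyEq h1).congr_deriv ?_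
  funext i
  fin_cases i <;> simp <;> ring

lemma direction_ne_zero (H : IsConeFront P h w₁ w₂ ρ g) :
    ![g 0, g 0 * w₁ 0 - h 0 * w₂ 0, g 0 * w₂ 0 + h 0 * w₁ 0] ≠ 0 := by
  intro h0
  have e0 : g 0 = 0 := congrFun h0 0
  have e1 : g 0 * w₁ 0 - h 0 * w₂ 0 = 0 := congrFun h0 1
  have e2 : g 0 * w₂ 0 + h 0 * w₁ 0 = 0 := congrFun h0 2
  have hw := H.circle.self_of_nhds
  rw [e0] at e1 e2
  have h1 : w₁ 0 = 0 := by simpa [H.h_ne_zero] using e2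
  have h2 : w₂ 0 = 0 := by simpa [H.h_ne_zero] using e1
  rw [h1, h2] at hw
  norm_num at hw

lemma deriv_eq_zero_iff (H : IsConeFront P h w₁ w₂ ρ g) : deriv P 0 = 0 ↔ ρ 0 = 0 := by
  rw [H.hasDerivAt.self_of_nhds.deriv, smul_eq_zero, or_iff_left H.direction_ne_zero]

/-- At a cusp, comparing the first components of `Φ ∘ P = (φ ^ 2, φ ^ 3, 0)` gives `ρ m = 2 φ φ'`
with some `m`, and the right-hand side has a simple zero. -/
lemma simple_zero_of_hasCusp (H : IsConeFront P h w₁ w₂ ρ g) (hP : HasCusp P 0) :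
    ρ 0 = 0 ∧ deriv ρ 0 ≠ 0 := by
  obtain ⟨φ, Φ, hφ, hφ0, hΦ, hΦ0, hcomp⟩ := hP
  have hφs : ContDiffAt ℝ ∞ φ 0 := contMDiffAt_iff_contDiffAt.1 hφ.contMDiffAt
  have hΦs : ContDiffAt ℝ ∞ Φ (P 0) := contMDiffAt_iff_contDiffAt.1 hΦ.contMDiffAt
  have hPd := H.hasDerivAt
  have hφ1 : deriv φ 0 ≠ 0 := by
    intro h0
    have h1 := injective_fderiv_of_isLocalDiffeomorphAt hφ
      (a₁ := 1) (a₂ := 0) (by rw [fderiv_apply_one_eq_deriv, h0, map_zero])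
    exact one_ne_zero h1
  have hφd : ∀ᶠ t in 𝓝 0, HasDerivAt φ (deriv φ t) t := by
    filter_upwards [(hφs.of_le (m := 1) (by simp)).eventually (by simp)] with t ht
    exact (ht.differentiableAt (by simp)).hasDerivAt
  have hΦd : ∀ᶠ t in 𝓝 0, HasFDerivAt Φ (fderiv ℝ Φ (P t)) (P t) := by
    have h1 := (hΦs.of_le (m := 1) (by simp)).eventually (by simp)
    filter_upwards [hPd.self_of_nhds.continuousAt.eventually h1] with t ht
    exact (ht.differentiableAt (by simp)).hasFDerivAt
  have hκ : ∀ᶠ t in 𝓝 0, HasDerivAt (fun t => ![φ t ^ 2, φ t ^ 3, 0])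
      ![2 * φ t * deriv φ t, 3 * φ t ^ 2 * deriv φ t, 0] t := by
    filter_upwards [hφd] with t ht
    refine (hasDerivAt_vec3 (ht.pow 2) (ht.pow 3) (hasDerivAt_const t 0)).congr_deriv ?_
    simp
  set ξ : ℝ → R31 := fun t => ![g t, g t * w₁ t - h t * w₂ t, g t * w₂ t + h t * w₁ t] with hξ
  have hkey : ∀ᶠ t in 𝓝 0, ρ t • fderiv ℝ Φ (P t) (ξ t) =
      ![2 * φ t * deriv φ t, 3 * φ t ^ 2 * deriv φ t, 0] := by
    filter_upwards [hΦd, hPd, hκ, hcomp.eventually_nhds] with t h1 h2 h3 h4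
    rw [← map_smul]
    exact (h1.comp_hasDerivAt t h2).unique (h3.congr_of_eventuallyEq h4)
  have hinj := injective_fderiv_of_isLocalDiffeomorphAt hΦ
  have hρ : ρ 0 = 0 := by
    have h1 := hkey.self_of_nhds
    rw [hφ0, ← map_smul] at h1
    have h2 : ρ 0 • ξ 0 = 0 := hinj (by rw [h1, map_zero]; funext i; fin_cases i <;> simp)
    exact (smul_eq_zero.1 h2).resolve_right H.direction_ne_zero
  refine ⟨hρ, fun hρ1 => ?_⟩
  have hξd : DifferentiableAt ℝ ξ 0 := by
    have hh := H.hasDerivAt_h.self_of_nhds.differentiableAt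
    have h1 := H.hasDerivAt_w₁.self_of_nhds.differentiableAt
    have h2 := H.hasDerivAt_w₂.self_of_nhds.differentiableAt
    exact (hasDerivAt_vec3 H.diff_g.hasDerivAt
      ((H.diff_g.mul h1).sub (hh.mul h2)).hasDerivAt
      ((H.diff_g.mul h2).add (hh.mul h1)).hasDerivAt).differentiableAt
  have hmd : DifferentiableAt ℝ (fun t => fderiv ℝ Φ (P t) (ξ t) 0) 0 := by
    have h1 : DifferentiableAt ℝ (fderiv ℝ Φ) (P 0) :=
      (hΦs.fderiv_right (m := ∞) (by simp)).differentiableAt (by simp)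
    have h2 : DifferentiableAt ℝ (fun t => fderiv ℝ Φ (P t)) 0 :=
      h1.comp 0 hPd.self_of_nhds.differentiableAt
    exact (differentiableAt_pi.1 (h2.clm_apply hξd)) 0
  have hkey0 : (fun t => ρ t * fderiv ℝ Φ (P t) (ξ t) 0) =ᶠ[𝓝 0] fun t => 2 * φ t * deriv φ t :=
    hkey.mono fun t ht => by simpa using congrFun ht 0
  have hd2 : DifferentiableAt ℝ (deriv φ) 0 := by
    have h1 : DifferentiableAt ℝ (fderiv ℝ φ) 0 :=
      (hφs.fderiv_right (m := ∞) (by simp)).differentiableAt (by simp)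
    simpa only [fderiv_apply_one_eq_deriv] using h1.clm_apply (differentiableAt_const (1 : ℝ))
  have hl := H.diff_ρ.hasDerivAt.mul hmd.hasDerivAt
  have hr := ((hφd.self_of_nhds.const_mul 2).mul hd2.hasDerivAt)
  have heq := hl.unique (hr.congr_of_eventuallyEq hkey0)
  rw [hρ, hρ1, hφ0] at heq
  have h3 : deriv φ 0 * deriv φ 0 = 0 := by linarith
  exact hφ1 (mul_self_eq_zero.1 h3)

/-- Near `b (1, a₁, a₂)` these coordinates straighten the lightcone to a plane. -/
lemma isLocalDiffeomorphAt_straighten {a₁ a₂ b : ℝ} (ha : a₁ ^ 2 + a₂ ^ 2 = 1) (hb : b ≠ 0) :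
    IsLocalDiffeomorphAt 𝓘(ℝ, R31) 𝓘(ℝ, R31) ∞
      (fun v : R31 => ![(a₁ * v 2 - a₂ * v 1) / v 0, v 0, v 1 ^ 2 + v 2 ^ 2 - v 0 ^ 2])
      ![b, b * a₁, b * a₂] := by
  have hsm : ∀ᶠ v : R31 in 𝓝 ![b, b * a₁, b * a₂], ContDiffAt ℝ ∞
      (fun v : R31 => ![(a₁ * v 2 - a₂ * v 1) / v 0, v 0, v 1 ^ 2 + v 2 ^ 2 - v 0 ^ 2]) v := by
    have h1 : ∀ᶠ v : R31 in 𝓝 ![b, b * a₁, b * a₂], v 0 ≠ 0 :=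
      (continuous_apply 0).continuousAt.eventually_ne (by simpa using hb)
    filter_upwards [h1] with v hv
    have hc : ∀ i : Fin 3, ContDiffAt ℝ ∞ (fun v : R31 => v i) v := fun i => by fun_prop
    exact contDiffAt_vec3 (((contDiffAt_const.mul (hc 2)).sub (contDiffAt_const.mul (hc 1))).div
      (hc 0) hv) (hc 0) ((((hc 1).pow 2).add ((hc 2).pow 2)).sub ((hc 0).pow 2))
  refine isLocalDiffeomorphAt_of_injective_fderiv hsm ?_
  rw [injective_iff_map_eq_zero]
  intro w hw
  have hl := hasDerivAt_apply_line (hsm.self_of_nhds.differentiableAt (by simp)) w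
  simp only [hw, Pi.zero_apply] at hl
  have hline : ∀ b c : ℝ, HasDerivAt (fun t : ℝ => b + t * c) c 0 := fun b c => by
    simpa using ((hasDerivAt_id (0 : ℝ)).mul_const c).const_add b
  have h0 : w 0 = 0 := (hline b (w 0)).unique (by simpa using hl 1)
  have h1 : a₁ * w 2 - a₂ * w 1 = 0 := by
    have h2 := ((((hline (b * a₂) (w 2)).const_mul a₁).sub
      ((hline (b * a₁) (w 1)).const_mul a₂)).div_const b).unique (by simpa [h0] using hl 0)
    simpa [hb] using h2
  have h2 : a₁ * w 1 + a₂ * w 2 = 0 := by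
    have h3 := ((((hline (b * a₁) (w 1)).pow 2).add ((hline (b * a₂) (w 2)).pow 2)).sub_const
      (b ^ 2)).unique (by simpa [h0] using hl 2)
    have h4 : 2 * b * (a₁ * w 1 + a₂ * w 2) = 0 := by
      simp at h3
      linear_combination h3
    simpa [hb] using h4
  have e1 : w 1 = 0 := by linear_combination a₁ * h2 - a₂ * h1 - w 1 * ha
  have e2 : w 2 = 0 := by linear_combination a₂ * h2 + a₁ * h1 - w 2 * ha
  funext i
  fin_cases i <;> assumption

lemma hasCusp_of_simple_zero (H : IsConeFront P h w₁ w₂ ρ g) (hg : deriv g 0 ≠ 0) (hρ : ρ 0 = 0)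
    (hρ1 : deriv ρ 0 ≠ 0) : HasCusp P 0 := by
  have hcirc := H.circle.self_of_nhds
  -- `x` and `k` are the sine and the cosine of the angle of `(w₁, w₂)` against its value at `0`.
  set x : ℝ → ℝ := fun t => w₁ 0 * w₂ t - w₂ 0 * w₁ t with hx
  set k : ℝ → ℝ := fun t => w₁ 0 * w₁ t + w₂ 0 * w₂ t with hk
  have hk0 : k 0 = 1 := by rw [← hcirc, hk]; ring
  have hxd : ∀ᶠ t in 𝓝 0, HasDerivAt x (ρ t * k t) t := by
    filter_upwards [H.hasDerivAt_w₁, H.hasDerivAt_w₂] with t h1 h2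
    exact ((h2.const_mul (w₁ 0)).sub (h1.const_mul (w₂ 0))).congr_deriv (by rw [hk]; ring)
  have hkd : HasDerivAt k 0 0 := by
    refine ((H.hasDerivAt_w₁.self_of_nhds.const_mul (w₁ 0)).add
      (H.hasDerivAt_w₂.self_of_nhds.const_mul (w₂ 0))).congr_deriv ?_
    rw [hρ]; ring
  have hkne : ∀ᶠ t in 𝓝 0, k t ≠ 0 := hkd.continuousAt.eventually_ne (by rw [hk0]; exact one_ne_zero)
  have hqd := H.diff_g.hasDerivAt.div hkd (by rw [hk0]; exact one_ne_zero)
  have hcusp : HasCusp (fun t => ![x t, h t, 0]) 0 := by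
    refine hasCusp_of_front (q := g / k) ?_ H.smooth_h hqd.differentiableAt ?_ ?_ ?_ ?_ ?_
    · filter_upwards [H.smooth_w₁, H.smooth_w₂] with t h1 h2
      exact (contDiffAt_const.mul h2).sub (contDiffAt_const.mul h1)
    · rw [hx]; ring
    · rw [hxd.self_of_nhds.deriv, hρ, zero_mul]
    · have h1 : deriv x =ᶠ[𝓝 0] ρ * k := hxd.mono fun t ht => ht.deriv
      rw [h1.deriv_eq, (H.diff_ρ.hasDerivAt.mul hkd).deriv, hk0]
      simpa using hρ1
    · filter_upwards [hxd, H.hasDerivAt_h, hkne] with t h1 h2 h3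
      rw [h1.deriv, h2.deriv, Pi.div_apply]
      field_simp
    · rw [hqd.deriv, hk0]
      simpa using hg
  refine hcusp.of_comp (c := P)
    (by
      rw [H.eq.self_of_nhds]
      exact isLocalDiffeomorphAt_straighten hcirc H.h_ne_zero) ?_
  have hhne : ∀ᶠ t in 𝓝 0, h t ≠ 0 :=
    H.hasDerivAt_h.self_of_nhds.continuousAt.eventually_ne H.h_ne_zero
  filter_upwards [H.eq, H.circle, hhne] with t h1 h2 h3
  rw [h1]
  funext i
  fin_cases i
  · simp [hx]
    field_simp
  · simp
  · simp
    linear_combination h t ^ 2 * h2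

end IsConeFront

/-! ### Lightcone pedals -/

/-- The invariants of the lightcone pedal of a unit speed curve `c` with respect to a field `V` of
lightlike normal vectors: it is a front on the lightcone whose angular velocity `ρ` agrees with
`⟨c'', V⟩` up to a factor `κ` that does not vanish at `0`. -/
lemma exists_isConeFront_lightconePedal {c V : ℝ → R31} (hc : ∀ᶠ u in 𝓝 0, ContDiffAt ℝ ∞ c u)
    (hV : ∀ᶠ u in 𝓝 0, ContDiffAt ℝ ∞ V u)
    (hee : ∀ᶠ u in 𝓝 0, mink (deriv c u) (deriv c u) = 1)
    (heV : ∀ᶠ u in 𝓝 0, mink (deriv c u) (V u) = 0) (hVV : ∀ᶠ u in 𝓝 0, mink (V u) (V u) = 0)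
    (hV0 : V 0 0 ≠ 0) (hP : lightconePedal c V 0 ≠ 0) :
    ∃ h w₁ w₂ ρ g κ : ℝ → ℝ, IsConeFront (lightconePedal c V) h w₁ w₂ ρ g ∧
      DifferentiableAt ℝ κ 0 ∧ κ 0 ≠ 0 ∧ (∀ᶠ u in 𝓝 0, alpha c V u = κ u * ρ u) ∧
      (ρ 0 = 0 → deriv g 0 ≠ 0) := by
  have hci : ∀ i, ∀ᶠ u in 𝓝 0, ContDiffAt ℝ ∞ (fun u => c u i) u := fun i =>
    hc.mono fun u hu => contDiffAt_pi.1 hu i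
  have hVi : ∀ i, ∀ᶠ u in 𝓝 0, ContDiffAt ℝ ∞ (fun u => V u i) u := fun i =>
    hV.mono fun u hu => contDiffAt_pi.1 hu i
  have hVne : ∀ᶠ u in 𝓝 0, V u 0 ≠ 0 :=
    (hVi 0).self_of_nhds.continuousAt.eventually_ne hV0
  have hder : ∀ {E : Type} [NormedAddCommGroup E] [NormedSpace ℝ E] {z : ℝ → E} {u : ℝ},
      ContDiffAt ℝ ∞ z u → HasDerivAt z (deriv z u) u ∧ HasDerivAt (deriv z) (deriv (deriv z) u) u := by
    intro E _ _ z u hz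
    refine ⟨(hz.differentiableAt (by simp)).hasDerivAt, DifferentiableAt.hasDerivAt ?_⟩
    have h1 : DifferentiableAt ℝ (fderiv ℝ z) u :=
      (hz.fderiv_right (m := ∞) (by simp)).differentiableAt (by simp)
    simpa only [fderiv_apply_one_eq_deriv] using h1.clm_apply (differentiableAt_const (1 : ℝ))
  have hcd : ∀ i, ∀ᶠ u in 𝓝 0, HasDerivAt (fun u => c u i) (deriv c u i) u ∧
      HasDerivAt (fun u => deriv c u i) (deriv (deriv c) u i) u := fun i =>
    hc.mono fun u hu => ⟨hasDerivAt_pi.1 (hder hu).1 i, hasDerivAt_pi.1 (hder hu).2 i⟩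
  set w₁ : ℝ → ℝ := fun u => V u 1 / V u 0 with hw₁
  set w₂ : ℝ → ℝ := fun u => V u 2 / V u 0 with hw₂
  have hs₁ : ∀ᶠ u in 𝓝 0, ContDiffAt ℝ ∞ w₁ u := by
    filter_upwards [hVi 1, hVi 0, hVne] with u h1 h0 hne using h1.div h0 hne
  have hs₂ : ∀ᶠ u in 𝓝 0, ContDiffAt ℝ ∞ w₂ u := by
    filter_upwards [hVi 2, hVi 0, hVne] with u h1 h0 hne using h1.div h0 hne
  have hcirc : ∀ᶠ u in 𝓝 0, w₁ u ^ 2 + w₂ u ^ 2 = 1 := by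
    filter_upwards [hVV, hVne] with u h1 h2
    simp only [mink] at h1
    simp only [hw₁, hw₂]
    field_simp
    linear_combination h1
  have hVw : ∀ᶠ u in 𝓝 0, ∀ v : R31,
      mink v (V u) = V u 0 * (-v 0 + v 1 * w₁ u + v 2 * w₂ u) := by
    filter_upwards [hVne] with u h2 v
    simp only [mink, hw₁, hw₂]
    field_simp
  set ρ : ℝ → ℝ := fun u => w₁ u * deriv w₂ u - w₂ u * deriv w₁ u with hρ
  have hwd : ∀ᶠ u in 𝓝 0, HasDerivAt w₁ (-(ρ u * w₂ u)) u ∧ HasDerivAt w₂ (ρ u * w₁ u) u := by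
    filter_upwards [hs₁, hs₂, hcirc.eventually_nhds] with u h1 h2 h3
    have d1 := (hder h1).1
    have d2 := (hder h2).1
    have d3 := ((d1.pow 2).add (d2.pow 2)).unique
      ((hasDerivAt_const u (1 : ℝ)).congr_of_eventuallyEq h3)
    have h4 : w₁ u * deriv w₁ u + w₂ u * deriv w₂ u = 0 := by
      simp at d3
      linear_combination d3 / 2
    have h5 := h3.self_of_nhds
    refine ⟨d1.congr_deriv ?_, d2.congr_deriv ?_⟩
    · linear_combination w₁ u * h4 - deriv w₁ u * h5
    · linear_combination w₂ u * h4 - deriv w₂ u * h5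
  have hρd : DifferentiableAt ℝ ρ 0 := by
    have h1 := hder hs₁.self_of_nhds
    have h2 := hder hs₂.self_of_nhds
    exact ((h1.1.mul h2.2).sub (h2.1.mul h1.2)).differentiableAt
  set h : ℝ → ℝ := fun u => -c u 0 + c u 1 * w₁ u + c u 2 * w₂ u with hh
  set g : ℝ → ℝ := fun u => c u 2 * w₁ u - c u 1 * w₂ u with hg
  set σ : ℝ → ℝ := fun u => deriv c u 2 * w₁ u - deriv c u 1 * w₂ u with hσ
  have horth : ∀ᶠ u in 𝓝 0, -deriv c u 0 + deriv c u 1 * w₁ u + deriv c u 2 * w₂ u = 0 := by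
    filter_upwards [heV, hVw, hVne] with u h1 h2 h3
    rw [h2] at h1
    exact (mul_eq_zero.1 h1).resolve_left h3
  have hσ2 : σ 0 ^ 2 = 1 := by
    have h1 := hee.self_of_nhds
    have h2 := horth.self_of_nhds
    have h3 := hcirc.self_of_nhds
    simp only [mink] at h1
    simp only [hσ]
    linear_combination h1 + (deriv c 0 1 ^ 2 + deriv c 0 2 ^ 2) * h3 -
      (deriv c 0 0 + deriv c 0 1 * w₁ 0 + deriv c 0 2 * w₂ 0) * h2
  have hσ0 : σ 0 ≠ 0 := fun h0 => by rw [h0] at hσ2; norm_num at hσ2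
  have hgd : HasDerivAt g (σ 0 - ρ 0 * (c 0 1 * w₁ 0 + c 0 2 * w₂ 0)) 0 := by
    have h1 := hwd.self_of_nhds
    refine (((hcd 2).self_of_nhds.1.mul h1.1).sub
      ((hcd 1).self_of_nhds.1.mul h1.2)).congr_deriv ?_
    simp only [hσ]
    ring
  have hσd : DifferentiableAt ℝ σ 0 := by
    have h1 := hwd.self_of_nhds
    exact (((hcd 2).self_of_nhds.2.mul h1.1).sub
      ((hcd 1).self_of_nhds.2.mul h1.2)).differentiableAt
  have hPeq : ∀ᶠ u in 𝓝 0, lightconePedal c V u = ![h u, h u * w₁ u, h u * w₂ u] := by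
    filter_upwards [hVne] with u hu
    have h1 : tilde (V u) = ![1, w₁ u, w₂ u] := by
      funext i
      fin_cases i <;> simp [tilde, hw₁, hw₂, hu, div_eq_inv_mul]
    rw [lightconePedal, h1]
    funext i
    fin_cases i <;> simp [mink, hh]
  refine ⟨h, w₁, w₂, ρ, g, fun u => -(V u 0 * σ u), ⟨?_, hs₁, hs₂, hρd, hgd.differentiableAt, hPeq,
    hcirc, hwd.mono fun u hu => hu.1, hwd.mono fun u hu => hu.2, ?_, fun h0 => hP ?_⟩, ?_, ?_, ?_, ?_⟩
  · filter_upwards [hci 0, hci 1, hci 2, hs₁, hs₂] with u h0 h1 h2 h3 h4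
    exact (h0.neg.add (h1.mul h3)).add (h2.mul h4)
  · filter_upwards [hcd 0, hcd 1, hcd 2, hwd, horth] with u h0 h1 h2 h3 h4
    refine ((h0.1.neg.add (h1.1.mul h3.1)).add (h2.1.mul h3.2)).congr_deriv ?_
    simp only [hg]
    linear_combination h4
  · rw [hPeq.self_of_nhds, h0]
    funext i
    fin_cases i <;> simp
  · exact (((hVi 0).self_of_nhds.differentiableAt (by simp)).mul hσd).neg
  · exact neg_ne_zero.2 (mul_ne_zero hV0 hσ0)
  · -- Differentiate `⟨c', (1, w₁, w₂)⟩ = 0`.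
    filter_upwards [hcd 0, hcd 1, hcd 2, hwd, horth.eventually_nhds, hVw] with u h0 h1 h2 h3 h4 h5
    have h6 := (((h0.2.neg.add (h1.2.mul h3.1)).add (h2.2.mul h3.2))).unique
      ((hasDerivAt_const u (0 : ℝ)).congr_of_eventuallyEq h4)
    rw [alpha, h5]
    simp only [hσ]
    linear_combination V u 0 * h6
  · intro h0
    rw [hgd.deriv, h0]
    simpa using hσ0

/-- The criteria for the singularities of the lightcone pedal of a unit speed curve with respect to
one field of lightlike normal vectors. -/
theorem lightconePedal_singularities {c V : ℝ → R31} (hc : ∀ᶠ u in 𝓝 0, ContDiffAt ℝ ∞ c u)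
    (hV : ∀ᶠ u in 𝓝 0, ContDiffAt ℝ ∞ V u)
    (hee : ∀ᶠ u in 𝓝 0, mink (deriv c u) (deriv c u) = 1)
    (heV : ∀ᶠ u in 𝓝 0, mink (deriv c u) (V u) = 0) (hVV : ∀ᶠ u in 𝓝 0, mink (V u) (V u) = 0)
    (hV0 : V 0 0 ≠ 0) (hP : lightconePedal c V 0 ≠ 0) :
    (IsSingularPoint (lightconePedal c V) 0 ↔ alpha c V 0 = 0) ∧
      (HasCusp (lightconePedal c V) 0 ↔ alpha c V 0 = 0 ∧ deriv (alpha c V) 0 ≠ 0) := by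
  obtain ⟨h, w₁, w₂, ρ, g, κ, H, hκ, hκ0, hα, hg⟩ :=
    exists_isConeFront_lightconePedal hc hV hee heV hVV hV0 hP
  have h0 : alpha c V 0 = 0 ↔ ρ 0 = 0 := by
    rw [hα.self_of_nhds, mul_eq_zero, or_iff_right hκ0]
  have h1 : ρ 0 = 0 → deriv (alpha c V) 0 = κ 0 * deriv ρ 0 := by
    intro hρ
    have h2 : alpha c V =ᶠ[𝓝 0] κ * ρ := hα
    rw [h2.deriv_eq, (hκ.hasDerivAt.mul H.diff_ρ.hasDerivAt).deriv, hρ, mul_zero, zero_add]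
  refine ⟨by rw [IsSingularPoint, H.deriv_eq_zero_iff, h0], fun hcusp => ?_, fun ⟨hα0, hα1⟩ => ?_⟩
  · obtain ⟨hρ, hρ1⟩ := H.simple_zero_of_hasCusp hcusp
    exact ⟨h0.2 hρ, by rw [h1 hρ]; exact mul_ne_zero hκ0 hρ1⟩
  · have hρ := h0.1 hα0
    rw [h1 hρ] at hα1
    exact H.hasCusp_of_simple_zero (hg hρ) hρ (right_ne_zero_of_mul hα1)

/-- A lightlike vector has a non-zero time component. -/
lemma apply_zero_ne_zero_of_mink {v w : R31} (hv : mink v v = 0) (hvw : mink v w = 1) :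
    v 0 ≠ 0 := by
  intro h0
  simp only [mink, h0] at hv hvw
  have h1 : v 1 = 0 := by nlinarith [sq_nonneg (v 1), sq_nonneg (v 2)]
  have h2 : v 2 = 0 := by nlinarith [sq_nonneg (v 1), sq_nonneg (v 2)]
  rw [h1, h2] at hvw
  norm_num at hvw

end LightconePedal

theorem mainTheorem2 (U : Set (ℝ × ℝ)) (f : ℝ × ℝ → R31) (ν : ℝ × ℝ → ℙ ℝ R31)
    (ε : ℝ) (γ : ℝ → ℝ × ℝ) (L N : ℝ → R31)
    (hf : IsAdmissible U f ν ε γ) (hframe : IsFrame f ν ε γ L N) :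
    (IsLightlike (lightconePedal (f ∘ γ) L 0) →
      (IsSingularPoint (lightconePedal (f ∘ γ) L) 0 ↔ alpha (f ∘ γ) L 0 = 0) ∧
      (HasCusp (lightconePedal (f ∘ γ) L) 0 ↔
        alpha (f ∘ γ) L 0 = 0 ∧ deriv (alpha (f ∘ γ) L) 0 ≠ 0)) ∧
    (IsLightlike (lightconePedal (f ∘ γ) N 0) →
      (IsSingularPoint (lightconePedal (f ∘ γ) N) 0 ↔ alpha (f ∘ γ) N 0 = 0) ∧
      (HasCusp (lightconePedal (f ∘ γ) N) 0 ↔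
        alpha (f ∘ γ) N 0 = 0 ∧ deriv (alpha (f ∘ γ) N) 0 ≠ 0)) := by
  have h0 : (0 : ℝ) ∈ Ioo (-ε) ε := ⟨neg_lt_zero.2 hf.pos, hf.pos⟩
  have hI : ∀ᶠ u in 𝓝 (0 : ℝ), u ∈ Ioo (-ε) ε := Ioo_mem_nhds h0.1 h0.2
  have hsm : ∀ {z : ℝ → R31}, ContDiffOn ℝ ∞ z (Ioo (-ε) ε) → ∀ᶠ u in 𝓝 0, ContDiffAt ℝ ∞ z u :=
    fun hz => hI.mono fun u hu => hz.contDiffAt (Ioo_mem_nhds hu.1 hu.2)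
  have hmaps : MapsTo γ (Ioo (-ε) ε) U := by
    obtain ⟨W, -, -, hW⟩ := hf.image
    intro u hu
    have h1 : γ u ∈ lightlikePoints U ν ∩ W := hW ▸ mem_image_of_mem γ hu
    exact h1.1.1
  have hc := hsm (hf.frontal.smooth.comp hf.smooth hmaps)
  have hee := hI.mono hframe.ee
  refine ⟨fun hP => ?_, fun hP => ?_⟩
  · exact lightconePedal_singularities hc (hsm hframe.smooth_L) hee (hI.mono hframe.eL)
      (hI.mono hframe.LL) (apply_zero_ne_zero_of_mink (hframe.LL 0 h0) (hframe.LN 0 h0)) hP.1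
  · refine lightconePedal_singularities hc (hsm hframe.smooth_N) hee (hI.mono hframe.eN)
      (hI.mono hframe.NN) (apply_zero_ne_zero_of_mink (w := L 0) (hframe.NN 0 h0) ?_) hP.1
    rw [← hframe.LN 0 h0]
    simp only [mink]
    ring
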